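/- **Theorem 4.2.** Let $d\ge 1$ and $k\ge 2$. Let $\psi:[0,\infty)\to\mathbb R$ be continuous, and $C^2$ on $(0,\infty)$, with $\psi'(z)>0$ for all large $z$, $\psi(z)\to\infty$ and $(1/\psi')'(z)\to 0$ as $z\to\infty$. Put $a=1/\psi'$ and $\psi^{\leftarrow}(y)=\inf\{z\ge 0:\psi(z)\ge y\}$. Assume that $a$ is eventually non-increasing and that $\psi$ is regularly varying at infinity with index $v$ for some $1<v<\infty$, i.e. $\psi(tz)/\psi(z)\to t^{v}$ as $z\to\infty$ for every $t>0$. Let $C>0$ be such that $$f(x)=C\,e^{-\psi(\|x\|)},\qquad x\in\mathbb R^d,$$ is a probability density, with $\|\cdot\|$ the Euclidean norm. Let $X_1,X_2,\dots$ be i.i.d. random vectors in $\mathbb R^d$ with density $f$; for each $n\ge 1$ let $N_n$ be a Poisson random variable with mean $n$, independent of $(X_i)_{i\ge 1}$, and let $\mathcal P_n=\{X_1,\dots,X_{N_n}\}$, a Poisson point process with intensity $nf$. Let $(r_n)_{n\ge 1}$ be a non-increasing sequence of positive numbers with $r_n\to 0$ that is regularly varying, i.e. for some $\rho\in\mathbb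 R$ we have $r_{\lfloor tn\rfloor}/r_n\to t^{\rho}$ as $n\to\infty$ for every $t>0$. Let $(R_{k,n})_{n\ge 1}$ be a non-decreasing sequence of non-negative numbers with $$n^k\, r_n^{d(k-1)}\, a(R_{k,n})\, R_{k,n}^{d-1}\, f(R_{k,n}e_1)^k\to 1 \quad\text{and}\quad \frac{a(R_{k,n})}{r_n}\to 0\qquad (n\to\infty),$$ where $e_1=(1,0,\dots,0)$. Assume moreover that $$\frac{a(\psi^{\leftarrow}(\log n))}{r_n}\,\log\log n\to 0\qquad (n\to\infty).$$ Then there are sequences of radii $0<R_n^{(0)}\le R_n^{(1)}$, $n\ge1$, such that, with $B(x;\rho)$ the closed ball of radius $\rho$ about $x$, $$\mathbb P\Bigl\{B\bigl(0;R_n^{(0)}\bigr)\subset\bigcup_{X\in\mathcal P_n\cap B(0;R_n^{(0)})}B(X;r_n),\ \ \mathcal P_n\cap B\bigl(0;R_n^{(1)}\bigr)^c=\emptyset\Bigr\}\to 1\qquad(n\to\infty)$$ and $$\frac{R_n^{(1)}-R_n^{(0)}}{r_n}\to 0\qquad(n\to\infty).$$ -/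

import Mathlib

open Set Filter Topology MeasureTheory ProbabilityTheory

/-- `U` is regularly varying at infinity with index `ρ`: it is positive and measurable on a
half-line `[x₀, ∞)`, and `U (t z) / U z → t ^ ρ` as `z → ∞`, for every `t > 0`. -/
def RegularlyVarying (U : ℝ → ℝ) (ρ : ℝ) : Prop :=
  (∃ x₀ : ℝ, (∀ z, x₀ ≤ z → 0 < U z) ∧ Measurable (fun z : Ici x₀ => U z)) ∧
    ∀ t : ℝ, 0 < t → Tendsto (fun z => U (t * z) / U z) atTop (𝓝 (t ^ ρ))

/-- The sequence `u` is regularly varying (with some real index `ρ`): its terms are eventually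
positive, and `u ⌊t n⌋ / u n → t ^ ρ` as `n → ∞`, for every `t > 0`. -/
def RegularlyVaryingSeq (u : ℕ → ℝ) : Prop :=
  (∀ᶠ n in atTop, 0 < u n) ∧
    ∃ ρ : ℝ, ∀ t : ℝ, 0 < t →
      Tendsto (fun n : ℕ => u ⌊t * (n : ℝ)⌋₊ / u n) atTop (𝓝 (t ^ ρ))

/-- The auxiliary function `a = 1 / ψ'`. -/
noncomputable def auxFun (ψ : ℝ → ℝ) (z : ℝ) : ℝ := 1 / deriv ψ z

/-- `ψ`, regarded as a function on `[0, ∞)`, is continuous there, is `C²` on `(0, ∞)`, and is of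
von Mises type at infinity: `ψ' > 0` near infinity, `ψ → ∞` and `(1 / ψ')' → 0`. -/
structure IsVonMises (ψ : ℝ → ℝ) : Prop where
  continuousOn : ContinuousOn ψ (Ici 0)
  contDiffOn : ContDiffOn ℝ 2 ψ (Ioi 0)
  deriv_pos : ∀ᶠ z in atTop, 0 < deriv ψ z
  tendsto_atTop : Tendsto ψ atTop atTop
  tendsto_deriv_auxFun : Tendsto (deriv (auxFun ψ)) atTop (𝓝 0)

/-- The (left-continuous, generalized) inverse `ψ^← (y) = inf {z ≥ 0 : ψ z ≥ y}`. -/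
noncomputable def genInv (ψ : ℝ → ℝ) (y : ℝ) : ℝ := sInf {z | 0 ≤ z ∧ y ≤ ψ z}

/-- The radial profile `t ↦ C exp (-ψ t)` of the density, that is, the value of the density at
every point of norm `t`, such as `t e₁`. -/
noncomputable def radialDensity (C : ℝ) (ψ : ℝ → ℝ) (t : ℝ) : ℝ := C * Real.exp (-ψ t)

/-- The set of the first `N n ω` sample points. With the `X i` i.i.d. with density `f` and `N n`
Poisson with mean `n`, independent of the `X i`, these are the atoms of the Poisson point process
with intensity `n f`. -/
def sampleCloud {Ω E : Type*} (X : ℕ → Ω → E) (N : ℕ → Ω → ℕ) (n : ℕ) (ω : Ω) : Set E :=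
  {x | ∃ i < N n ω, X i ω = x}

/-! Put `L = log n`, `T = ψ^←(L)`, so that `n exp (-ψ T) = 1`, and take the radii `T ∓ w` with `w =
A a(T) log L`. Their difference is `2 A a(T) log L`, which the strengthened smallness condition
makes `o(r_n)`.

Since `a` is eventually non-increasing, `ψ` is eventually convex. Beyond `T + w` it thus exceeds `L
+ A log L`, and the expected number of points there is a power of `L` times `L ^ (-A/2)`
(`exists_lintegral_compl_closedBall_le`). Regular variation keeps `ψ'` comparable on `[T/2, T]`, so
inside `T - w` one has `ψ ≤ L - A log L / K²` (`exists_eventually_genInv_bounds`). As `r_n` is at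
least of order `1 / L`, every ball of radius `r_n / 4` inside has mean count at least of order `L²`.
Polynomially many in `L` such balls suffice for covering, and a union bound over their void
probabilities finishes (`one_le_measure_cover_add`). -/

/-! ### Void probabilities. -/

/-- The void probability of a Poissonized i.i.d. sample. -/
theorem measure_forall_lt_notMem_eq {Ω E : Type*} [MeasurableSpace Ω] [MeasurableSpace E]
    {μ : Measure Ω} [IsProbabilityMeasure μ] {ν : Measure E} {X : ℕ → Ω → E} {N : Ω → ℕ}
    (hXm : ∀ i, Measurable (X i)) (hXindep : iIndepFun X μ) (hXlaw : ∀ i, μ.map (X i) = ν)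
    (hNm : Measurable N) (lam : NNReal) (hNlaw : μ.map N = poissonMeasure lam)
    (hind : IndepFun N (fun ω i => X i ω) μ) {S : Set E} (hS : MeasurableSet S) :
    MeasurableSet {ω | ∀ i < N ω, X i ω ∉ S} ∧
      μ {ω | ∀ i < N ω, X i ω ∉ S} = ENNReal.ofReal (Real.exp (-(lam * ν.real S))) := by
  have hν : IsProbabilityMeasure ν := by
    rw [← hXlaw 0]
    exact Measure.isProbabilityMeasure_map (hXm 0).aemeasurable
  set A : ℕ → Set (ℕ → E) := fun m => ⋂ i ∈ Finset.range m, (fun x => x i) ⁻¹' Sᶜ with hA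
  have hAm : ∀ m, MeasurableSet (A m) := fun m =>
    Finset.measurableSet_biInter _ fun i _ => measurable_pi_apply i hS.compl
  have hXs : Measurable fun ω i => X i ω := measurable_pi_lambda _ hXm
  -- Slicing by the value of `N` turns the void probability into a Poisson-weighted sum of the
  -- powers `(1 - ν S) ^ m`, an exponential series.
  have hset : {ω | ∀ i < N ω, X i ω ∉ S} =
      ⋃ m, N ⁻¹' {m} ∩ (fun ω i => X i ω) ⁻¹' A m := by
    ext ω
    simp [hA]
  have hmeas : ∀ m, MeasurableSet (N ⁻¹' {m} ∩ (fun ω i => X i ω) ⁻¹' A m) := fun m =>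
    (hNm (measurableSet_singleton m)).inter (hXs (hAm m))
  refine ⟨hset ▸ MeasurableSet.iUnion hmeas, ?_⟩
  have hq : ν Sᶜ = ENNReal.ofReal (1 - ν.real S) := by
    rw [prob_compl_eq_one_sub hS, ENNReal.ofReal_sub _ measureReal_nonneg, ENNReal.ofReal_one,
      ofReal_measureReal]
  have hq0 : 0 ≤ 1 - ν.real S := sub_nonneg.2 measureReal_le_one
  have hterm : ∀ m, μ (N ⁻¹' {m} ∩ (fun ω i => X i ω) ⁻¹' A m) =
      ENNReal.ofReal (Real.exp (-lam) * ((lam * (1 - ν.real S)) ^ m / (m.factorial))) := by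
    intro m
    rw [indepFun_iff_measure_inter_preimage_eq_mul.1 hind _ _ (measurableSet_singleton m) (hAm m),
      ← Measure.map_apply hNm (measurableSet_singleton m), hNlaw, poissonMeasure_singleton]
    have h1 : (fun ω i => X i ω) ⁻¹' A m = ⋂ i ∈ Finset.range m, X i ⁻¹' Sᶜ := by
      ext ω
      simp [hA]
    rw [h1, iIndepFun_iff_measure_inter_preimage_eq_mul.1 hXindep (Finset.range m)
      (sets := fun _ => Sᶜ) (fun _ _ => hS.compl)]
    have h2 : ∀ i ∈ Finset.range m, μ (X i ⁻¹' Sᶜ) = ENNReal.ofReal (1 - ν.real S) := fun i _ => by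
      rw [← Measure.map_apply (hXm i) hS.compl, hXlaw, hq]
    rw [Finset.prod_congr rfl h2, Finset.prod_const, Finset.card_range, ← ENNReal.ofReal_pow hq0,
      ← ENNReal.ofReal_mul (by positivity)]
    congr 1
    rw [mul_pow]
    ring
  have hsum : HasSum (fun m : ℕ => Real.exp (-lam) *
      ((lam * (1 - ν.real S)) ^ m / (m.factorial : ℝ))) (Real.exp (-(lam * ν.real S))) := by
    have h := (NormedSpace.expSeries_div_hasSum_exp ((lam : ℝ) * (1 - ν.real S))).mul_left
      (Real.exp (-lam))
    rw [← Real.exp_eq_exp_ℝ, ← Real.exp_add] at h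
    rw [show -((lam : ℝ) * ν.real S) = -lam + lam * (1 - ν.real S) by ring]
    exact h
  rw [hset, measure_iUnion _ hmeas]
  · simp_rw [hterm]
    rw [← ENNReal.ofReal_tsum_of_nonneg _ hsum.summable, hsum.tsum_eq]
    intro m
    have : 0 ≤ (lam : ℝ) * (1 - ν.real S) := mul_nonneg lam.2 hq0
    positivity
  · intro i j hij
    refine Set.disjoint_left.2 fun ω h1 h2 => hij ?_
    exact (h1.1 : N ω = i).symm.trans h2.1

/-! ### Nets of balls and deterministic covering. -/

section Covering

variable {E : Type*} [NormedAddCommGroup E] [NormedSpace ℝ E] [FiniteDimensional ℝ E]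

/-- The volume bound for separated subsets of a ball. -/
theorem card_le_of_separated_of_subset_closedBall {ρ s : ℝ} (hρ : 0 ≤ ρ) (hs : 0 < s)
    {F : Finset E} (hF : (F : Set E) ⊆ Metric.closedBall 0 ρ)
    (hsep : (F : Set E).Pairwise fun x y => s < dist x y) :
    (F.card : ℝ) ≤ ((2 * ρ + s) / s) ^ Module.finrank ℝ E := by
  let : MeasurableSpace E := borel E
  have : BorelSpace E := ⟨rfl⟩
  let m : Measure E := Measure.addHaar
  have hle : m (⋃ x ∈ F, Metric.closedBall x (s / 2)) ≤ m (Metric.closedBall 0 (ρ + s / 2)) := by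
    refine measure_mono (iUnion₂_subset fun x hx => ?_)
    refine Metric.closedBall_subset_closedBall' ?_
    have := Metric.mem_closedBall.1 (hF hx)
    linarith
  rw [measure_biUnion_finset (fun x hx y hy hxy =>
    Metric.closedBall_disjoint_closedBall (by have := hsep hx hy hxy; linarith))
    (fun x _ => measurableSet_closedBall)] at hle
  simp_rw [Measure.addHaar_closedBall' m _ (half_pos hs).le] at hle
  rw [Measure.addHaar_closedBall' m _ (by positivity : (0 : ℝ) ≤ ρ + s / 2), Finset.sum_const,
    nsmul_eq_mul, ← mul_assoc] at hle
  have hpos : m (Metric.closedBall 0 1) ≠ 0 :=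
    (Metric.measure_closedBall_pos m 0 one_pos).ne'
  have hfin : m (Metric.closedBall 0 1) ≠ ⊤ := measure_closedBall_lt_top.ne
  rw [ENNReal.mul_le_mul_iff_left hpos hfin] at hle
  rw [← ENNReal.ofReal_natCast, ← ENNReal.ofReal_mul (by positivity),
    ENNReal.ofReal_le_ofReal_iff (by positivity)] at hle
  have h2 : (2 * ρ + s) / s = (ρ + s / 2) / (s / 2) := by field_simp
  rw [h2, div_pow, le_div_iff₀ (by positivity)]
  exact hle

/-- A closed ball has a finite net with few points. -/
theorem exists_finset_net_closedBall {ρ s : ℝ} (hρ : 0 ≤ ρ) (hs : 0 < s) :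
    ∃ F : Finset E, (F : Set E) ⊆ Metric.closedBall 0 ρ ∧
      (∀ x ∈ Metric.closedBall (0 : E) ρ, ∃ c ∈ F, dist x c ≤ s) ∧
      (F.card : ℝ) ≤ ((2 * ρ + s) / s) ^ Module.finrank ℝ E := by
  classical
  let P : ℕ → Prop := fun m => ∃ F : Finset E, F.card = m ∧ (F : Set E) ⊆ Metric.closedBall 0 ρ ∧
    (F : Set E).Pairwise fun x y => s < dist x y
  obtain ⟨b, hb⟩ := exists_nat_ge (((2 * ρ + s) / s) ^ Module.finrank ℝ E)
  have hbd : ∀ m, P m → m ≤ b := by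
    rintro m ⟨F, rfl, hF, hsep⟩
    exact_mod_cast (card_le_of_separated_of_subset_closedBall hρ hs hF hsep).trans hb
  have h0 : P 0 := ⟨∅, by simp⟩
  -- A separated set of maximal cardinality is a net: a point far from all its members could be
  -- added.
  obtain ⟨F, hcard, hF, hsep⟩ : P (Nat.findGreatest P b) :=
    Nat.findGreatest_spec (Nat.zero_le b) h0
  refine ⟨F, hF, fun x hx => ?_, card_le_of_separated_of_subset_closedBall hρ hs hF hsep⟩
  by_contra! hcon
  have hxF : x ∉ F := fun h => by
    have := hcon x h
    rw [dist_self] at this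
    linarith
  have hP : P (F.card + 1) := by
    refine ⟨insert x F, Finset.card_insert_of_notMem hxF, ?_, ?_⟩
    · rw [Finset.coe_insert]
      exact insert_subset hx hF
    · rw [Finset.coe_insert]
      refine hsep.insert fun y hy _ => ⟨hcon y hy, ?_⟩
      rw [dist_comm]
      exact hcon y hy
  have := Nat.le_findGreatest (hbd _ hP) hP
  omega

/-- Few small balls inside a closed ball, such that any set that meets all of them covers the
large ball at scale `r` from inside. -/
theorem exists_finset_forall_inter_nonempty_imp_subset {ρ r : ℝ} (hr : 0 < r) (hρ : r ≤ ρ) :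
    ∃ F : Finset E, (F.card : ℝ) ≤ (8 * ρ / r) ^ Module.finrank ℝ E ∧
      (∀ c ∈ F, Metric.closedBall c (r / 4) ⊆ Metric.closedBall 0 ρ) ∧
      ∀ P : Set E, (∀ c ∈ F, (P ∩ Metric.closedBall c (r / 4)).Nonempty) →
        Metric.closedBall 0 ρ ⊆ ⋃ x ∈ P ∩ Metric.closedBall 0 ρ, Metric.closedBall x r := by
  -- The net lives in the ball shrunk by `r / 4`, so that the small balls stay inside. A point `y`
  -- is pulled radially into the shrunk ball; the three hops to `y'`, to a centre and to a point of
  -- `P` cost `r / 4` each.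
  obtain ⟨F, hF, hnet, hcard⟩ := exists_finset_net_closedBall (E := E)
    (ρ := ρ - r / 4) (s := r / 4) (by linarith) (by linarith)
  have hsub : ∀ c ∈ F, Metric.closedBall c (r / 4) ⊆ Metric.closedBall 0 ρ := fun c hc => by
    refine Metric.closedBall_subset_closedBall' ?_
    have := Metric.mem_closedBall.1 (hF hc)
    linarith
  have hρ0 : 0 < ρ := hr.trans_le hρ
  refine ⟨F, hcard.trans ?_, hsub, fun P hP y hy => ?_⟩
  · have h1 : 0 ≤ 2 * (ρ - r / 4) + r / 4 := by linarith
    refine pow_le_pow_left₀ (by positivity) ?_ _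
    rw [div_le_div_iff₀ (by positivity) hr]
    nlinarith
  · rw [mem_closedBall_zero_iff] at hy
    set y' : E := (1 - r / (4 * ρ)) • y with hy'
    have hle : r / (4 * ρ) ≤ 1 := by
      rw [div_le_one (by positivity)]
      linarith
    have hnorm : ‖y'‖ ≤ ρ - r / 4 := by
      rw [hy', norm_smul, Real.norm_of_nonneg (by linarith)]
      calc (1 - r / (4 * ρ)) * ‖y‖ ≤ (1 - r / (4 * ρ)) * ρ :=
            mul_le_mul_of_nonneg_left hy (by linarith)
        _ = ρ - r / 4 := by field_simp
    have hdist : dist y y' ≤ r / 4 := by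
      rw [dist_eq_norm, hy', show y - (1 - r / (4 * ρ)) • y = (r / (4 * ρ)) • y by module,
        norm_smul, Real.norm_of_nonneg (by positivity)]
      calc r / (4 * ρ) * ‖y‖ ≤ r / (4 * ρ) * ρ := mul_le_mul_of_nonneg_left hy (by positivity)
        _ = r / 4 := by field_simp
    obtain ⟨c, hc, hyc⟩ := hnet y' (mem_closedBall_zero_iff.2 hnorm)
    obtain ⟨x, hxP, hxc⟩ := hP c hc
    refine mem_iUnion₂.2 ⟨x, ⟨hxP, hsub c hc hxc⟩, ?_⟩
    rw [Metric.mem_closedBall] at hxc ⊢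
    have h1 := dist_triangle4 y y' c x
    rw [dist_comm c x] at h1
    linarith

end Covering

/-! ### Growth of `ψ` and tails of the density. -/

namespace IsVonMises

variable {ψ : ℝ → ℝ}

/-- Continuity makes the infimum attained, and the intermediate value theorem excludes overshoot; `ψ
0 < y` is needed, since otherwise the infimum is `0`. -/
theorem genInv_spec (hψ : IsVonMises ψ) {y : ℝ} (hy : ψ 0 < y) :
    0 ≤ genInv ψ y ∧ ψ (genInv ψ y) = y := by
  set S : Set ℝ := {z | 0 ≤ z ∧ y ≤ ψ z} with hS
  have hne : S.Nonempty := by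
    obtain ⟨z, hz0, hz⟩ := ((eventually_ge_atTop (0 : ℝ)).and
      (hψ.tendsto_atTop.eventually_ge_atTop y)).exists
    exact ⟨z, hz0, hz⟩
  have hbdd : BddBelow S := ⟨0, fun z hz => hz.1⟩
  have hclosed : IsClosed S := hψ.continuousOn.preimage_isClosed_of_isClosed isClosed_Ici isClosed_Ici
  have hmem : genInv ψ y ∈ S := hclosed.csInf_mem hne hbdd
  refine ⟨hmem.1, le_antisymm ?_ hmem.2⟩
  obtain ⟨z, hz, hzy⟩ := intermediate_value_Icc hmem.1
    (hψ.continuousOn.mono Icc_subset_Ici_self) ⟨hy.le, hmem.2⟩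
  have hle : genInv ψ y ≤ z := csInf_le hbdd ⟨hz.1, hzy.ge⟩
  rw [← le_antisymm hz.2 hle, hzy]

/-- On an initial segment, `ψ` is maximal at the right end point, if that is large. -/
theorem eventually_forall_le (hψ : IsVonMises ψ) :
    ∀ᶠ z in atTop, ∀ s, 0 ≤ s → s ≤ z → ψ s ≤ ψ z := by
  obtain ⟨x₀, hx₀⟩ := eventually_atTop.1 (hψ.deriv_pos.and (eventually_gt_atTop (0 : ℝ)))
  have hmono : StrictMonoOn ψ (Ici x₀) := by
    refine strictMonoOn_of_deriv_pos (convex_Ici x₀)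
      (hψ.continuousOn.mono (Ici_subset_Ici.2 (hx₀ x₀ le_rfl).2.le)) fun x hx => ?_
    rw [interior_Ici] at hx
    exact (hx₀ x (le_of_lt hx)).1
  -- Below `x₀` monotonicity may fail, but compactness bounds `ψ` there and `ψ z` eventually exceeds
  -- the bound.
  obtain ⟨M, hM⟩ := (isCompact_Icc.image_of_continuousOn
    (hψ.continuousOn.mono (Icc_subset_Ici_self : Icc 0 x₀ ⊆ Ici 0))).bddAbove
  filter_upwards [hψ.tendsto_atTop.eventually_ge_atTop M, eventually_ge_atTop x₀]
    with z hz hzx s hs hsz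
  rcases le_total s x₀ with h | h
  · exact (hM ⟨s, ⟨hs, h⟩, rfl⟩).trans hz
  · exact hmono.monotoneOn h hzx hsz

theorem tendsto_genInv (hψ : IsVonMises ψ) : Tendsto (genInv ψ) atTop atTop := by
  refine Filter.tendsto_atTop.2 fun b => ?_
  obtain ⟨z, hz, hzb⟩ := (hψ.eventually_forall_le.and (eventually_ge_atTop b)).exists
  filter_upwards [eventually_gt_atTop (ψ 0), eventually_gt_atTop (ψ z)] with y h0 hy
  obtain ⟨h1, h2⟩ := hψ.genInv_spec h0
  by_contra! hlt
  have := hz _ h1 (hlt.le.trans hzb)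
  linarith

/-- Convexity of `ψ` near infinity. -/
theorem exists_monotoneOn_deriv (hψ : IsVonMises ψ)
    (ha : ∃ x₀ : ℝ, AntitoneOn (auxFun ψ) (Ioi x₀)) :
    ∃ x₀ : ℝ, 1 ≤ x₀ ∧ (∀ x, x₀ ≤ x → 0 < deriv ψ x) ∧ MonotoneOn (deriv ψ) (Ici x₀) ∧
      ∀ x y, x₀ ≤ x → x ≤ y →
        deriv ψ x * (y - x) ≤ ψ y - ψ x ∧ ψ y - ψ x ≤ deriv ψ y * (y - x) := by
  obtain ⟨x₁, hx₁⟩ := ha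
  obtain ⟨x₀, hx₀⟩ := eventually_atTop.1 ((hψ.deriv_pos.and (eventually_gt_atTop x₁)).and
    (eventually_ge_atTop (1 : ℝ)))
  have hpos : ∀ x, x₀ ≤ x → 0 < deriv ψ x := fun x hx => (hx₀ x hx).1.1
  have hmono : MonotoneOn (deriv ψ) (Ici x₀) := fun x hx y hy hxy =>
    (one_div_le_one_div (hpos y hy) (hpos x hx)).1 (hx₁ (hx₀ x hx).1.2 (hx₀ y hy).1.2 hxy)
  refine ⟨x₀, (hx₀ x₀ le_rfl).2, hpos, hmono, fun x y hx hxy => ?_⟩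
  rcases hxy.eq_or_lt with rfl | hlt
  · simp
  have h1 : (1 : ℝ) ≤ x := (hx₀ x hx).2
  obtain ⟨c, hc, hder⟩ := exists_deriv_eq_slope ψ hlt
    (hψ.continuousOn.mono fun z hz => (by simp; linarith [hz.1] : z ∈ Ici (0 : ℝ)))
    ((hψ.contDiffOn.differentiableOn (by norm_num)).mono fun z hz =>
      (by simp; linarith [hz.1] : z ∈ Ioi (0 : ℝ)))
  rw [eq_div_iff (sub_pos.2 hlt).ne'] at hder
  have hcx : x₀ ≤ c := hx.trans hc.1.le
  rw [← hder]
  exact ⟨mul_le_mul_of_nonneg_right (hmono hx hcx hc.1.le) (sub_pos.2 hlt).le,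
    mul_le_mul_of_nonneg_right (hmono hcx (hx.trans hxy) hc.2.le) (sub_pos.2 hlt).le⟩

/-- Under regular variation, `z ψ' z` and `ψ z` are of the same order. -/
theorem exists_deriv_bounds (hψ : IsVonMises ψ)
    (ha : ∃ x₀ : ℝ, AntitoneOn (auxFun ψ) (Ioi x₀)) {v : ℝ} (hv : 0 < v)
    (hψv : RegularlyVarying ψ v) :
    ∃ K : ℝ, 1 ≤ K ∧ ∀ᶠ z in atTop, z * deriv ψ z ≤ K * ψ z ∧
      ψ z ≤ K * (z * deriv ψ (z / 2)) ∧ z ≤ K * ψ z := by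
  obtain ⟨x₀, hx₀, hpos, hmono, htan⟩ := hψ.exists_monotoneOn_deriv ha
  set p : ℝ := (1 / 2 : ℝ) ^ v with hp
  set q : ℝ := (1 / 4 : ℝ) ^ v with hq
  have hpq : 0 < (p - q) / 2 := by
    have : q < p := Real.rpow_lt_rpow (by norm_num) (by norm_num) hv
    linarith
  -- Convexity compares `z ψ'(z)` with `ψ(2z) - ψ(z)` from above, and `z ψ'(z/2) / 4` with `ψ(z/2) -
  -- ψ(z/4)` from below; regular variation makes both increments of order `ψ(z)`.
  have h2 := (hψv.2 2 (by norm_num)).eventually_le_const (lt_add_one ((2 : ℝ) ^ v))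
  have hd := ((hψv.2 (1 / 2) (by norm_num)).sub (hψv.2 (1 / 4) (by norm_num))).eventually_const_le
    (show (p - q) / 2 < p - q by linarith)
  set m := deriv ψ x₀ with hm
  have hm0 : 0 < m := hpos x₀ le_rfl
  set K : ℝ := max 1 (max ((2 : ℝ) ^ v + 1) (max (((p - q) / 2)⁻¹) (((2 : ℝ) ^ v + 1) / m))) with hK
  have hK1 : (2 : ℝ) ^ v + 1 ≤ K := (le_max_left _ _).trans (le_max_right _ _)
  have hK2 : ((p - q) / 2)⁻¹ ≤ K :=
    (le_max_left _ _).trans ((le_max_right _ _).trans (le_max_right _ _))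
  have hK3 : ((2 : ℝ) ^ v + 1) / m ≤ K :=
    (le_max_right _ _).trans ((le_max_right _ _).trans (le_max_right _ _))
  refine ⟨K, le_max_left _ _, ?_⟩
  filter_upwards [h2, hd, hψ.tendsto_atTop.eventually_gt_atTop 0, eventually_ge_atTop (4 * x₀)]
    with z hz2 hzd hz0 hzx
  have hzpos : 0 < z := by linarith
  have e1 : z * deriv ψ z ≤ ((2 : ℝ) ^ v + 1) * ψ z := by
    rw [div_le_iff₀ hz0] at hz2
    have := (htan z (2 * z) (by linarith) (by linarith)).1
    nlinarith
  refine ⟨e1.trans (mul_le_mul_of_nonneg_right hK1 hz0.le), ?_, ?_⟩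
  · rw [← sub_div, le_div_iff₀ hz0] at hzd
    have h3 := (htan (1 / 4 * z) (1 / 2 * z) (by linarith) (by linarith)).2
    have h4 : z / 2 = 1 / 2 * z := by ring
    have h5 : 0 < deriv ψ (1 / 2 * z) := hpos _ (by linarith)
    rw [h4]
    have h6 : (p - q) / 2 * ψ z ≤ z * deriv ψ (1 / 2 * z) := by nlinarith [mul_pos hzpos h5]
    calc ψ z = ((p - q) / 2)⁻¹ * ((p - q) / 2 * ψ z) := (inv_mul_cancel_left₀ hpq.ne' _).symm
      _ ≤ ((p - q) / 2)⁻¹ * (z * deriv ψ (1 / 2 * z)) :=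
        mul_le_mul_of_nonneg_left h6 (inv_pos.2 hpq).le
      _ ≤ K * (z * deriv ψ (1 / 2 * z)) := mul_le_mul_of_nonneg_right hK2 (by positivity)
  · have h3 : m ≤ deriv ψ z := hmono (le_refl x₀) (show x₀ ≤ z by linarith) (by linarith)
    have h4 : z * m ≤ ((2 : ℝ) ^ v + 1) * ψ z :=
      (mul_le_mul_of_nonneg_left h3 hzpos.le).trans e1
    calc z ≤ ((2 : ℝ) ^ v + 1) * ψ z / m := (le_div_iff₀ hm0).2 h4
      _ = ((2 : ℝ) ^ v + 1) / m * ψ z := by ring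
      _ ≤ K * ψ z := mul_le_mul_of_nonneg_right hK3 hz0.le

/-- The mass that the density puts outside a ball whose radius exceeds `T` by `u / ψ' T`. -/
theorem exists_lintegral_compl_closedBall_le {E : Type*} [NormedAddCommGroup E] [NormedSpace ℝ E]
    [FiniteDimensional ℝ E] [MeasurableSpace E] [BorelSpace E] (m : Measure E) [m.IsAddHaarMeasure]
    (hψ : IsVonMises ψ) (ha : ∃ x₀ : ℝ, AntitoneOn (auxFun ψ) (Ioi x₀)) {C : ℝ} (hC : 0 < C) :
    ∃ I : ℝ, 0 ≤ I ∧ ∀ᶠ T in atTop, ∀ u, 0 ≤ u →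
      ∫⁻ x in (Metric.closedBall (0 : E) (T + u / deriv ψ T))ᶜ,
          ENNReal.ofReal (radialDensity C ψ ‖x‖) ∂m ≤
        ENNReal.ofReal (I * (1 + T) ^ (Module.finrank ℝ E + 1) * Real.exp (-ψ T - u / 2)) := by
  obtain ⟨x₀, hx₀, hpos, hmono, htan⟩ := hψ.exists_monotoneOn_deriv ha
  set n := Module.finrank ℝ E + 1 with hn
  set c := deriv ψ x₀ with hc
  have hc0 : 0 < c := hpos x₀ le_rfl
  -- Chosen so that `b (1 + t) ≤ 1 + c t / (2n) ≤ exp (c t / (2n))` for `t ≥ 0`; the `n`-th power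
  -- then costs `exp (c t / 2)`.
  set b : ℝ := min 1 (c / (2 * n)) with hb
  have hn0 : (0 : ℝ) < n := by positivity
  have hb0 : 0 < b := lt_min one_pos (by positivity)
  have hJlt := finite_integral_one_add_norm (E := E) (μ := m) (r := (n : ℝ))
    (by rw [hn]; push_cast; linarith)
  set J := ∫⁻ x : E, ENNReal.ofReal ((1 + ‖x‖) ^ (-(n : ℝ))) ∂m with hJ
  refine ⟨C * (b ^ n)⁻¹ * J.toReal, by positivity, ?_⟩
  filter_upwards [eventually_ge_atTop x₀] with T hT u hu
  have hT0 : 0 < T := by linarith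
  have hd := hpos T hT
  set M : ℝ := C * (b ^ n)⁻¹ * (1 + T) ^ n * Real.exp (-ψ T - u / 2) with hM
  have hM0 : 0 ≤ M := by positivity
  have hpt : ∀ x ∈ (Metric.closedBall (0 : E) (T + u / deriv ψ T))ᶜ,
      ENNReal.ofReal (radialDensity C ψ ‖x‖) ≤
        ENNReal.ofReal M * ENNReal.ofReal ((1 + ‖x‖) ^ (-(n : ℝ))) := by
    intro x hx
    rw [mem_compl_iff, mem_closedBall_zero_iff, not_le] at hx
    rw [← ENNReal.ofReal_mul hM0]
    refine ENNReal.ofReal_le_ofReal ?_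
    set s := ‖x‖ with hs
    have hud : 0 ≤ u / deriv ψ T := by positivity
    have hsT : 0 < s - T := by linarith
    have h1 := (htan T s hT (by linarith)).1
    have h2 : u ≤ deriv ψ T * (s - T) := by
      have : u / deriv ψ T ≤ s - T := by linarith
      rw [div_le_iff₀ hd] at this
      linarith
    have h3 : c * (s - T) ≤ deriv ψ T * (s - T) :=
      mul_le_mul_of_nonneg_right (hmono (le_refl x₀) hT hT) hsT.le
    -- Half of the linear growth of `ψ` past `T` yields `u / 2`; the other half pays for the
    -- integrable weight `(1 + s) ^ (-n)`.
    have h4 : -ψ s ≤ (-ψ T - u / 2) + -(c * (s - T) / 2) := by linarith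
    have h5 : b * (1 + s) ≤ (1 + T) * Real.exp (c * (s - T) / (2 * n)) := by
      have e1 : b ≤ 1 := min_le_left _ _
      have e2 : b * (s - T) ≤ c / (2 * n) * (s - T) :=
        mul_le_mul_of_nonneg_right (min_le_right _ _) hsT.le
      have e3 := Real.add_one_le_exp (c * (s - T) / (2 * n))
      have e4 : c / (2 * n) * (s - T) = c * (s - T) / (2 * n) := by ring
      have e5 : b * (1 + (s - T)) ≤ Real.exp (c * (s - T) / (2 * n)) := by linarith
      calc b * (1 + s) ≤ b * ((1 + T) * (1 + (s - T))) :=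
            mul_le_mul_of_nonneg_left (by nlinarith) hb0.le
        _ = (1 + T) * (b * (1 + (s - T))) := by ring
        _ ≤ _ := mul_le_mul_of_nonneg_left e5 (by linarith)
    have hs0 : 0 < 1 + s := by linarith
    have h6 : b ^ n * (1 + s) ^ n ≤ (1 + T) ^ n * Real.exp (c * (s - T) / 2) := by
      have := pow_le_pow_left₀ (by positivity) h5 n
      rw [mul_pow, mul_pow, ← Real.exp_nat_mul] at this
      rwa [show (n : ℝ) * (c * (s - T) / (2 * n)) = c * (s - T) / 2 by field_simp] at this
    have h7 : Real.exp (-(c * (s - T) / 2)) ≤ (b ^ n)⁻¹ * (1 + T) ^ n * ((1 + s) ^ n)⁻¹ := by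
      rw [Real.exp_neg, inv_mul_eq_div, ← div_eq_mul_inv, div_div, inv_eq_one_div,
        div_le_div_iff₀ (Real.exp_pos _) (by positivity), one_mul]
      exact h6
    rw [Real.rpow_neg hs0.le, Real.rpow_natCast, radialDensity, hM]
    calc C * Real.exp (-ψ s) ≤ C * (Real.exp (-ψ T - u / 2) * Real.exp (-(c * (s - T) / 2))) := by
          rw [← Real.exp_add]
          exact mul_le_mul_of_nonneg_left (Real.exp_le_exp.2 h4) hC.le
      _ ≤ C * (Real.exp (-ψ T - u / 2) * ((b ^ n)⁻¹ * (1 + T) ^ n * ((1 + s) ^ n)⁻¹)) := by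
          gcongr
      _ = _ := by ring
  calc _ ≤ ∫⁻ x in (Metric.closedBall (0 : E) (T + u / deriv ψ T))ᶜ,
          ENNReal.ofReal M * ENNReal.ofReal ((1 + ‖x‖) ^ (-(n : ℝ))) ∂m :=
        setLIntegral_mono' measurableSet_closedBall.compl hpt
    _ ≤ ∫⁻ x, ENNReal.ofReal M * ENNReal.ofReal ((1 + ‖x‖) ^ (-(n : ℝ))) ∂m :=
        setLIntegral_le_lintegral _ _
    _ = ENNReal.ofReal M * J := lintegral_const_mul' _ _ ENNReal.ofReal_ne_top
    _ = ENNReal.ofReal (M * J.toReal) := by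
        rw [ENNReal.ofReal_mul hM0, ENNReal.ofReal_toReal hJlt.ne]
    _ = _ := by
        congr 1
        rw [hM]
        ring

/-- The two radii at distance `A log y / ψ' T` from `T = ψ^← y`. -/
theorem exists_eventually_genInv_bounds (hψ : IsVonMises ψ)
    (ha : ∃ x₀ : ℝ, AntitoneOn (auxFun ψ) (Ioi x₀)) {v : ℝ} (hv : 0 < v)
    (hψv : RegularlyVarying ψ v) :
    ∃ K : ℝ, 1 ≤ K ∧ ∀ A : ℝ, 0 ≤ A → ∀ᶠ y in atTop,
      1 ≤ genInv ψ y ∧ ψ (genInv ψ y) = y ∧ 0 < deriv ψ (genInv ψ y) ∧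
      genInv ψ y ≤ K * y ∧ deriv ψ (genInv ψ y) ≤ K * y ∧
      genInv ψ y / 2 ≤ genInv ψ y - A * Real.log y / deriv ψ (genInv ψ y) ∧
      ∀ s, 0 ≤ s → s ≤ genInv ψ y - A * Real.log y / deriv ψ (genInv ψ y) →
        ψ s ≤ y - A * Real.log y / K ^ 2 := by
  obtain ⟨x₀, hx₀, hpos, hmono, htan⟩ := hψ.exists_monotoneOn_deriv ha
  obtain ⟨K, hK1, hK⟩ := hψ.exists_deriv_bounds ha hv hψv
  have hK0 : 0 < K := by linarith
  refine ⟨K, hK1, fun A hA => ?_⟩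
  obtain ⟨x₁, hx₁⟩ := eventually_atTop.1 hψ.eventually_forall_le
  -- With `y = ψ T ≤ K T ψ'(T/2) ≤ K T ψ'(T)`, this makes the shift at most `T / 2`.
  have hlog : ∀ᶠ y : ℝ in atTop, 2 * K * (A * Real.log y) ≤ y := by
    have h := Real.isLittleO_log_id_atTop.const_mul_left (2 * K * A)
    filter_upwards [h.bound one_pos, eventually_ge_atTop (0 : ℝ)] with y hy hy0
    rw [id, one_mul, Real.norm_of_nonneg hy0] at hy
    calc 2 * K * (A * Real.log y) = 2 * K * A * Real.log y := by ring
      _ ≤ y := (Real.le_norm_self _).trans hy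
  filter_upwards [hψ.tendsto_genInv.eventually hK,
    hψ.tendsto_genInv.eventually_ge_atTop (2 * x₀), hψ.tendsto_genInv.eventually_ge_atTop (2 * x₁),
    hlog, eventually_gt_atTop (ψ 0), eventually_ge_atTop (1 : ℝ)] with y hKy hT0 hT1 hly hy0 hy1
  have hTy := (hψ.genInv_spec hy0).2
  set T := genInv ψ y with hT
  set u := A * Real.log y with hu
  have hu0 : 0 ≤ u := mul_nonneg hA (Real.log_nonneg hy1)
  rw [hTy] at hKy
  obtain ⟨k1, k2, k3⟩ := hKy
  have hTpos : 0 < T := by linarith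
  have hD := hpos T (by linarith)
  have hD' := hpos (T / 2) (by linarith)
  have hDD : deriv ψ (T / 2) ≤ deriv ψ T :=
    hmono (show x₀ ≤ T / 2 by linarith) (show x₀ ≤ T by linarith) (by linarith)
  have hhalf : u / deriv ψ T ≤ T / 2 := by
    rw [div_le_iff₀ hD]
    have h1 : 2 * K * u ≤ K * (T * deriv ψ T) :=
      (hly.trans k2).trans (by gcongr)
    have h2 : K * (2 * u) ≤ K * (T * deriv ψ T) := by linarith
    have h3 := le_of_mul_le_mul_left h2 hK0
    linarith
  refine ⟨by linarith, hTy, hD, k3, ?_, by linarith, fun s hs0 hs => ?_⟩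
  · have : 1 * deriv ψ T ≤ T * deriv ψ T := by gcongr; linarith
    linarith
  · have hR : T / 2 ≤ T - u / deriv ψ T := by linarith
    have hud : 0 ≤ u / deriv ψ T := by positivity
    have h1 := hx₁ (T - u / deriv ψ T) (by linarith) s hs0 hs
    have h2 := (htan (T - u / deriv ψ T) T (by linarith) (by linarith)).1
    have h3 : deriv ψ (T / 2) ≤ deriv ψ (T - u / deriv ψ T) :=
      hmono (show x₀ ≤ T / 2 by linarith) (show x₀ ≤ T - u / deriv ψ T by linarith) hR
    -- Chaining the two comparisons with `ψ T` is the source of `K ^ 2`.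
    have h4 : deriv ψ T ≤ K ^ 2 * deriv ψ (T / 2) := by
      have : T * deriv ψ T ≤ T * (K ^ 2 * deriv ψ (T / 2)) :=
        calc T * deriv ψ T ≤ K * (K * (T * deriv ψ (T / 2))) :=
              k1.trans (mul_le_mul_of_nonneg_left k2 hK0.le)
          _ = _ := by ring
      exact le_of_mul_le_mul_left this hTpos
    have h5 : u / K ^ 2 ≤ deriv ψ (T - u / deriv ψ T) * (u / deriv ψ T) := by
      calc u / K ^ 2 = deriv ψ T * (u / deriv ψ T) / K ^ 2 := by field_simp
        _ ≤ K ^ 2 * deriv ψ (T / 2) * (u / deriv ψ T) / K ^ 2 := by gcongr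
        _ = deriv ψ (T / 2) * (u / deriv ψ T) := by field_simp
        _ ≤ _ := by gcongr
    rw [sub_sub_cancel, hTy] at h2
    linarith

end IsVonMises

/-! ### Probability estimates. -/

/-- A lower bound for the probability that a Poisson sample covers a ball from inside and stays in
a second ball. -/
theorem one_le_measure_cover_add {Ω E : Type*} [MeasurableSpace Ω] {μ : Measure Ω}
    [IsProbabilityMeasure μ] [NormedAddCommGroup E] [NormedSpace ℝ E] [FiniteDimensional ℝ E]
    [MeasurableSpace E] [BorelSpace E] {ν : Measure E} {X : ℕ → Ω → E} {N : ℕ → Ω → ℕ}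
    (hXm : ∀ i, Measurable (X i)) (hXindep : iIndepFun X μ) (hXlaw : ∀ i, μ.map (X i) = ν) {n : ℕ}
    (hNm : Measurable (N n)) {lam : NNReal} (hNlaw : μ.map (N n) = poissonMeasure lam)
    (hind : IndepFun (N n) (fun ω i => X i ω) μ) {r ρ₀ ρ₁ α β : ℝ} (hr : 0 < r) (hρ : r ≤ ρ₀)
    (hα : lam * ν.real (Metric.closedBall 0 ρ₁)ᶜ ≤ α)
    (hβ : ∀ c, Metric.closedBall c (r / 4) ⊆ Metric.closedBall 0 ρ₀ →
      β ≤ lam * ν.real (Metric.closedBall c (r / 4))) :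
    1 ≤ μ {ω |
          Metric.closedBall 0 ρ₀ ⊆
            ⋃ x ∈ sampleCloud X N n ω ∩ Metric.closedBall 0 ρ₀, Metric.closedBall x r ∧
          sampleCloud X N n ω ∩ (Metric.closedBall 0 ρ₁)ᶜ = ∅} +
        ENNReal.ofReal (α + (8 * ρ₀ / r) ^ Module.finrank ℝ E * Real.exp (-β)) := by
  obtain ⟨F, hcard, hsub, hcov⟩ :=
    exists_finset_forall_inter_nonempty_imp_subset (E := E) hr hρ
  set V : Set E → Set Ω := fun S => {ω | ∀ i < N n ω, X i ω ∉ S} with hV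
  have hvoid : ∀ S : Set E, MeasurableSet S → MeasurableSet (V S) ∧
      μ (V S) = ENNReal.ofReal (Real.exp (-(lam * ν.real S))) := fun S hS =>
    measure_forall_lt_notMem_eq hXm hXindep hXlaw hNm lam hNlaw hind hS
  have hα0 : 0 ≤ α := le_trans (by positivity) hα
  have hout : μ (V (Metric.closedBall 0 ρ₁)ᶜ)ᶜ ≤ ENNReal.ofReal α := by
    obtain ⟨h1, h2⟩ := hvoid _ (measurableSet_closedBall (x := (0 : E)) (ε := ρ₁)).compl
    rw [prob_compl_eq_one_sub h1, h2, ← ENNReal.ofReal_one, ← ENNReal.ofReal_sub _ (by positivity)]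
    refine ENNReal.ofReal_le_ofReal ?_
    have := Real.add_one_le_exp (-(lam * ν.real (Metric.closedBall 0 ρ₁)ᶜ))
    linarith
  have hin : μ (⋃ c ∈ F, V (Metric.closedBall c (r / 4))) ≤
      ENNReal.ofReal ((8 * ρ₀ / r) ^ Module.finrank ℝ E * Real.exp (-β)) := by
    calc μ (⋃ c ∈ F, V (Metric.closedBall c (r / 4)))
        ≤ ∑ c ∈ F, μ (V (Metric.closedBall c (r / 4))) := measure_biUnion_finset_le _ _
      _ ≤ ∑ c ∈ F, ENNReal.ofReal (Real.exp (-β)) := by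
          refine Finset.sum_le_sum fun c hc => ?_
          rw [(hvoid _ measurableSet_closedBall).2]
          exact ENNReal.ofReal_le_ofReal (Real.exp_le_exp.2 (neg_le_neg (hβ c (hsub c hc))))
      _ = ENNReal.ofReal (F.card * Real.exp (-β)) := by
          rw [Finset.sum_const, nsmul_eq_mul, ENNReal.ofReal_mul (by positivity),
            ENNReal.ofReal_natCast]
      _ ≤ _ := ENNReal.ofReal_le_ofReal
          (mul_le_mul_of_nonneg_right hcard (Real.exp_pos _).le)
  have hρ0 : 0 < ρ₀ := hr.trans_le hρ
  rw [ENNReal.ofReal_add hα0 (by positivity)]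
  refine le_trans ?_ (add_le_add le_rfl (add_le_add hout hin))
  -- The target event and the two bad events exhaust `Ω`. Subadditivity suffices, so measurability
  -- of the covering event is not needed.
  rw [← measure_univ (μ := μ)]
  refine (measure_mono fun ω _ => ?_).trans
    ((measure_union_le _ _).trans (add_le_add le_rfl (measure_union_le _ _)))
  by_contra hω
  simp only [mem_union, mem_compl_iff, mem_iUnion, not_or, not_not, not_exists] at hω
  obtain ⟨h1, h2, h3⟩ := hω
  refine h1 ⟨hcov _ fun c hc => ?_, ?_⟩
  · have := h3 c hc
    simp only [hV, mem_ofPred_eq, not_forall, not_not] at this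
    obtain ⟨i, hi, hx⟩ := this
    exact ⟨X i ω, ⟨i, hi, rfl⟩, hx⟩
  · rw [eq_empty_iff_forall_notMem]
    rintro x ⟨⟨i, hi, rfl⟩, hx⟩
    exact h2 i hi hx

/-- A lower bound for the mass of a small ball on which `ψ` is bounded above. -/
theorem le_real_withDensity_closedBall {E : Type*} [NormedAddCommGroup E] [NormedSpace ℝ E]
    [FiniteDimensional ℝ E] [MeasurableSpace E] [BorelSpace E] (m : Measure E) [m.IsAddHaarMeasure]
    {ψ : ℝ → ℝ} {C : ℝ} (hC : 0 < C)
    [IsFiniteMeasure (m.withDensity fun x => ENNReal.ofReal (radialDensity C ψ ‖x‖))]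
    {c : E} {s ρ M : ℝ} (hs : 0 ≤ s) (hsub : Metric.closedBall c s ⊆ Metric.closedBall 0 ρ)
    (hM : ∀ t, 0 ≤ t → t ≤ ρ → ψ t ≤ M) :
    C * Real.exp (-M) * (s ^ Module.finrank ℝ E * m.real (Metric.closedBall 0 1)) ≤
      (m.withDensity fun x => ENNReal.ofReal (radialDensity C ψ ‖x‖)).real
        (Metric.closedBall c s) := by
  refine (ENNReal.ofReal_le_iff_le_toReal (measure_ne_top _ _)).1 ?_
  rw [withDensity_apply _ measurableSet_closedBall]
  calc ENNReal.ofReal (C * Real.exp (-M) *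
        (s ^ Module.finrank ℝ E * m.real (Metric.closedBall 0 1)))
      = ENNReal.ofReal (C * Real.exp (-M)) * m (Metric.closedBall c s) := by
        rw [Measure.addHaar_closedBall' m c hs,
          ENNReal.ofReal_mul (by positivity : 0 ≤ C * Real.exp (-M)),
          ENNReal.ofReal_mul (pow_nonneg hs _), ofReal_measureReal measure_closedBall_lt_top.ne]
    _ = ∫⁻ _ in Metric.closedBall c s, ENNReal.ofReal (C * Real.exp (-M)) ∂m :=
        (setLIntegral_const _ _).symm
    _ ≤ _ := by
        refine setLIntegral_mono' measurableSet_closedBall fun x hx => ENNReal.ofReal_le_ofReal ?_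
        exact mul_le_mul_of_nonneg_left (Real.exp_le_exp.2 (neg_le_neg
          (hM _ (norm_nonneg x) (mem_closedBall_zero_iff.1 (hsub hx))))) hC.le

/-- With `y = log n` this is the failure bound: the mean number of escaping points, plus the number
of small balls times their void probability. -/
theorem tendsto_div_add_pow_mul_exp_neg {a b c : ℝ} (d : ℕ) (hc : 0 < c) :
    Tendsto (fun y : ℝ => a / y + (b * y ^ 2) ^ d * Real.exp (-(c * y ^ 2))) atTop (𝓝 0) := by
  have h1 : Tendsto (fun y : ℝ => a / y) atTop (𝓝 0) := tendsto_const_nhds.div_atTop tendsto_id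
  have h2 : Tendsto (fun y : ℝ => c * y ^ 2) atTop atTop :=
    (tendsto_pow_atTop two_ne_zero).const_mul_atTop hc
  have h3 := ((Real.tendsto_pow_mul_exp_neg_atTop_nhds_zero d).comp h2).const_mul ((b / c) ^ d)
  rw [mul_zero] at h3
  have h4 := h1.add h3
  rw [add_zero] at h4
  refine h4.congr fun y => ?_
  simp only [Function.comp_apply]
  rw [← mul_assoc, ← mul_pow]
  congr 3
  field_simp

/-! ### Choice of the radii and conclusion. -/

theorem theorem4p2
    {Ω : Type*} [MeasurableSpace Ω] (μ : Measure Ω) [IsProbabilityMeasure μ]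
    (d : ℕ) (hd : 1 ≤ d)
    -- the light-tailed density `f x = C exp (-ψ ‖x‖)`
    (ψ : ℝ → ℝ) (hψ : IsVonMises ψ)
    (v : ℝ) (hv : 1 < v) (hψv : RegularlyVarying ψ v)
    (ha : ∃ x₀ : ℝ, AntitoneOn (auxFun ψ) (Ioi x₀))
    (C : ℝ) (hC : 0 < C)
    -- the i.i.d. sample with density `f`, and the independent Poisson sample sizes
    (X : ℕ → Ω → EuclideanSpace ℝ (Fin d)) (hXm : ∀ i, Measurable (X i))
    (hXindep : iIndepFun X μ)
    (hXlaw : ∀ i, μ.map (X i) =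
      volume.withDensity (fun x => ENNReal.ofReal (radialDensity C ψ ‖x‖)))
    (N : ℕ → Ω → ℕ) (hNm : ∀ n, Measurable (N n))
    (hNlaw : ∀ n : ℕ, 1 ≤ n → μ.map (N n) = poissonMeasure (n : NNReal))
    (hNindep : ∀ n : ℕ, 1 ≤ n → IndepFun (N n) (fun ω i => X i ω) μ)
    -- the scales `r n`
    (r : ℕ → ℝ) (hrpos : ∀ n, 1 ≤ n → 0 < r n) (hranti : AntitoneOn r (Ici 1))
    (hrlim : Tendsto r atTop (𝓝 0)) (hrRV : RegularlyVaryingSeq r)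
    -- the normalizing radii `R_{k,n}`
    (k : ℕ) (hk : 2 ≤ k)
    (R : ℕ → ℝ) (hRnonneg : ∀ n, 1 ≤ n → 0 ≤ R n) (hRmono : MonotoneOn R (Ici 1))
    (hRnorm : Tendsto (fun n : ℕ =>
      (n : ℝ) ^ k * r n ^ (d * (k - 1)) * auxFun ψ (R n) * R n ^ (d - 1)
        * radialDensity C ψ (R n) ^ k) atTop (𝓝 1))
    (hRr : Tendsto (fun n => auxFun ψ (R n) / r n) atTop (𝓝 0))
    -- the strengthened smallness condition
    (hstrong : Tendsto (fun n : ℕ =>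
      auxFun ψ (genInv ψ (Real.log n)) / r n * Real.log (Real.log n)) atTop (𝓝 0)) :
    ∃ R₀ R₁ : ℕ → ℝ,
      (∀ n, 0 < R₀ n ∧ R₀ n ≤ R₁ n) ∧
      Tendsto (fun n => μ {ω |
          Metric.closedBall 0 (R₀ n) ⊆
            ⋃ x ∈ sampleCloud X N n ω ∩ Metric.closedBall 0 (R₀ n), Metric.closedBall x (r n) ∧
          sampleCloud X N n ω ∩ (Metric.closedBall 0 (R₁ n))ᶜ = ∅})
        atTop (𝓝 1) ∧
      Tendsto (fun n => (R₁ n - R₀ n) / r n) atTop (𝓝 0) := by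
  have hv0 : 0 < v := by linarith
  set ν : Measure (EuclideanSpace ℝ (Fin d)) :=
    volume.withDensity (fun x => ENNReal.ofReal (radialDensity C ψ ‖x‖)) with hν
  have hνp : IsProbabilityMeasure ν := by
    rw [← hXlaw 0]
    exact Measure.isProbabilityMeasure_map (hXm 0).aemeasurable
  have hfr : Module.finrank ℝ (EuclideanSpace ℝ (Fin d)) = d := finrank_euclideanSpace_fin
  obtain ⟨K, hK1, hK⟩ := hψ.exists_eventually_genInv_bounds ha hv0 hψv
  obtain ⟨I, hI0, hI⟩ := hψ.exists_lintegral_compl_closedBall_le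
    (volume : Measure (EuclideanSpace ℝ (Fin d))) ha hC
  rw [hfr] at hI
  have hK0 : 0 < K := by linarith
  -- Both `A / 2` and `A / K ^ 2` are at least `d + 2`. Outside, the factor `L ^ (-(d + 2))` beats
  -- `T ^ (d + 1)` and leaves `1 / L`; inside, `L ^ (d + 2)` beats the volume `r_n ^ d` and leaves
  -- `L ^ 2`.
  set A : ℝ := (K ^ 2 + 2) * (d + 2) with hA
  have hA0 : 0 ≤ A := by positivity
  set κ : ℝ := (volume : Measure (EuclideanSpace ℝ (Fin d))).real (Metric.closedBall 0 1) with hκ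
  have hκ0 : 0 < κ := ENNReal.toReal_pos
    (Metric.measure_closedBall_pos _ _ one_pos).ne' measure_closedBall_lt_top.ne
  set c₀ : ℝ := C * κ * (1 / (4 * K)) ^ d with hc₀
  have hc₀0 : 0 < c₀ := by positivity
  set T : ℕ → ℝ := fun n => genInv ψ (Real.log n) with hT
  set w : ℕ → ℝ := fun n => A * Real.log (Real.log n) / deriv ψ (T n) with hw
  have hLlim : Tendsto (fun n : ℕ => Real.log n) atTop atTop :=
    Real.tendsto_log_atTop.comp tendsto_natCast_atTop_atTop
  have hTlim : Tendsto T atTop atTop := hψ.tendsto_genInv.comp hLlim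
  have hgood : ∀ᶠ n in atTop, 0 < T n - w n ∧ T n - w n ≤ T n + w n := by
    filter_upwards [hLlim.eventually (hK A hA0), hLlim.eventually_ge_atTop 1] with n hn hL1
    obtain ⟨h1, -, h3, -, -, h6, -⟩ := hn
    have hw0 : 0 ≤ w n := div_nonneg (mul_nonneg hA0 (Real.log_nonneg hL1)) h3.le
    change 1 ≤ T n at h1
    change T n / 2 ≤ T n - w n at h6
    constructor <;> linarith
  classical
  -- The ordering is required for every `n`; the value `1` serves the finitely many `n` where the
  -- intended radii fail it.
  refine ⟨fun n => if 0 < T n - w n ∧ T n - w n ≤ T n + w n then T n - w n else 1,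
    fun n => if 0 < T n - w n ∧ T n - w n ≤ T n + w n then T n + w n else 1, ?_, ?_, ?_⟩
  · intro n
    dsimp only
    split_ifs with h
    · exact h
    · exact ⟨one_pos, le_rfl⟩
  · have hlim := (tendsto_div_add_pow_mul_exp_neg (a := I * (2 * K) ^ (d + 1)) (b := 8 * K ^ 2)
      d hc₀0).comp hLlim
    have hlim' := ENNReal.tendsto_ofReal hlim
    rw [ENNReal.ofReal_zero] at hlim'
    have hlow := ENNReal.Tendsto.sub (tendsto_const_nhds (x := (1 : ENNReal))) hlim'
      (Or.inl ENNReal.one_ne_top)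
    rw [tsub_zero] at hlow
    refine tendsto_of_tendsto_of_tendsto_of_le_of_le' hlow tendsto_const_nhds ?_
      (Eventually.of_forall fun n => prob_le_one)
    filter_upwards [hgood, hLlim.eventually (hK A hA0), hTlim.eventually hI,
      hLlim.eventually_ge_atTop (Real.exp 1), hstrong.eventually_lt_const one_pos,
      hrlim.eventually_lt_const (show (0 : ℝ) < 1 / 2 by norm_num), eventually_ge_atTop 1]
      with n hg hKn hIn hLe hsn hrn hn1
    obtain ⟨hT1, hTL, hD, hTK, hDK, hhalf, hmax⟩ := hKn
    simp only [if_pos hg]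
    rw [tsub_le_iff_right]
    set L := Real.log n with hL
    set l := Real.log L with hl
    have hLpos : 0 < L := (Real.exp_pos 1).trans_le hLe
    have hl1 : 1 ≤ l := (Real.le_log_iff_exp_le hLpos).2 hLe
    have hL1 : 1 ≤ L := le_trans (by have := Real.add_one_le_exp 1; linarith) hLe
    have hn0 : (0 : ℝ) < n := by exact_mod_cast hn1
    have hr0 := hrpos n hn1
    have hexpL : Real.exp (-L) = (n : ℝ)⁻¹ := by rw [Real.exp_neg, Real.exp_log hn0]
    -- Once `log L ≥ 1`, the strengthened condition gives `a(T) < r_n`, while `ψ'(T) ≤ K L`.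
    have hrL : 1 / (K * L) ≤ r n := by
      have h1 : 1 / deriv ψ (T n) * l < r n := by
        rw [auxFun, div_mul_eq_mul_div, div_lt_one hr0] at hsn
        exact hsn
      have h2 : 1 / deriv ψ (T n) * 1 ≤ 1 / deriv ψ (T n) * l :=
        mul_le_mul_of_nonneg_left hl1 (by positivity)
      have h3 : 1 / (K * L) ≤ 1 / deriv ψ (T n) := one_div_le_one_div_of_le hD hDK
      linarith
    have hrρ : r n ≤ T n - w n := by
      change T n / 2 ≤ T n - w n at hhalf
      change 1 ≤ T n at hT1
      linarith
    have hw0 : 0 ≤ w n := by linarith [hg.2]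
    have hu : 0 ≤ A * l := mul_nonneg hA0 (by linarith)
    have hA2 : (d + 2 : ℝ) * l ≤ A * l / 2 := by
      have : 0 ≤ K ^ 2 * ((d + 2 : ℝ) * l) := by positivity
      rw [hA]
      linarith
    have hAK : (d + 2 : ℝ) * l ≤ A * l / K ^ 2 := by
      have : 0 ≤ (d + 2 : ℝ) * l := by positivity
      rw [hA, le_div_iff₀ (by positivity)]
      linarith
    have hexpl : Real.exp ((d + 2 : ℝ) * l) = L ^ (d + 2) := by
      rw [show (d + 2 : ℝ) * l = ((d + 2 : ℕ) : ℝ) * l by push_cast; ring, Real.exp_nat_mul, hl,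
        Real.exp_log hLpos]
    have hα : ((n : NNReal) : ℝ) * ν.real (Metric.closedBall 0 (T n + w n))ᶜ ≤
        I * (2 * K) ^ (d + 1) / L := by
      have h1 : ν.real (Metric.closedBall 0 (T n + w n))ᶜ ≤
          I * (1 + T n) ^ (d + 1) * Real.exp (-L - A * l / 2) := by
        refine ENNReal.toReal_le_of_le_ofReal (mul_nonneg (mul_nonneg hI0
          (pow_nonneg (by linarith [hg.1]) _)) (Real.exp_pos _).le) ?_
        rw [hν, withDensity_apply _ measurableSet_closedBall.compl]
        have := hIn (A * l) hu
        rwa [show ψ (T n) = L from hTL] at this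
      have h2 : Real.exp (-L - A * l / 2) ≤ (n : ℝ)⁻¹ * (L ^ (d + 2))⁻¹ := by
        rw [← hexpL, ← hexpl, ← Real.exp_neg, ← Real.exp_add]
        exact Real.exp_le_exp.2 (by linarith)
      have h3 : 1 + T n ≤ 2 * K * L := by
        change T n ≤ K * L at hTK
        nlinarith
      have hT0 : 0 ≤ 1 + T n := by linarith [hg.1]
      calc ((n : NNReal) : ℝ) * ν.real (Metric.closedBall 0 (T n + w n))ᶜ
          ≤ n * (I * (2 * K * L) ^ (d + 1) * ((n : ℝ)⁻¹ * (L ^ (d + 2))⁻¹)) := by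
            rw [NNReal.coe_natCast]
            refine mul_le_mul_of_nonneg_left (h1.trans ?_) hn0.le
            gcongr
        _ = I * (2 * K) ^ (d + 1) / L := by
            rw [mul_pow, pow_succ L (d + 1)]
            field_simp
    have hβ : ∀ c : EuclideanSpace ℝ (Fin d),
        Metric.closedBall c (r n / 4) ⊆ Metric.closedBall 0 (T n - w n) →
        c₀ * L ^ 2 ≤ ((n : NNReal) : ℝ) * ν.real (Metric.closedBall c (r n / 4)) := by
      intro c hc
      have h1 := le_real_withDensity_closedBall volume hC (by positivity) hc hmax
      rw [hfr] at h1
      have h2 : (n : ℝ)⁻¹ * L ^ (d + 2) ≤ Real.exp (-(L - A * l / K ^ 2)) := by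
        rw [← hexpL, ← hexpl, ← Real.exp_add]
        exact Real.exp_le_exp.2 (by linarith)
      have h3 : 1 / (4 * K) * L⁻¹ ≤ r n / 4 := by
        calc 1 / (4 * K) * L⁻¹ = 1 / (K * L) / 4 := by field_simp
          _ ≤ r n / 4 := by linarith
      calc c₀ * L ^ 2
          = n * (C * ((n : ℝ)⁻¹ * L ^ (d + 2)) * ((1 / (4 * K) * L⁻¹) ^ d * κ)) := by
            rw [hc₀, mul_pow _ L⁻¹, pow_add, inv_pow]
            field_simp
        _ ≤ n * (C * Real.exp (-(L - A * l / K ^ 2)) * ((r n / 4) ^ d * κ)) := by gcongr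
        _ ≤ ((n : NNReal) : ℝ) * ν.real (Metric.closedBall c (r n / 4)) := by
            rw [NNReal.coe_natCast]
            exact mul_le_mul_of_nonneg_left h1 hn0.le
    refine (one_le_measure_cover_add hXm hXindep hXlaw (hNm n) (hNlaw n hn1) (hNindep n hn1)
      hr0 hrρ hα hβ).trans (add_le_add le_rfl (ENNReal.ofReal_le_ofReal ?_))
    simp only [Function.comp_apply]
    rw [hfr]
    have h8 : 8 * (T n - w n) / r n ≤ 8 * K ^ 2 * L ^ 2 := by
      rw [div_le_iff₀ hr0]
      have h1 : 1 ≤ r n * (K * L) := (div_le_iff₀ (by positivity)).1 hrL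
      change T n ≤ K * L at hTK
      calc 8 * (T n - w n) ≤ 8 * (K * L) * 1 := by linarith
        _ ≤ 8 * (K * L) * (r n * (K * L)) := by gcongr
        _ = _ := by ring
    have h9 : 0 ≤ 8 * (T n - w n) / r n := div_nonneg (by linarith [hg.1]) hr0.le
    gcongr
  · have h := hstrong.const_mul (2 * A)
    rw [mul_zero] at h
    refine h.congr' ?_
    filter_upwards [hgood] with n hg
    simp only [if_pos hg]
    simp only [auxFun, hw, hT]
    ring
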